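/- **Theorem.** Let $$f(x)=\tfrac1{128}\bigl(150\sin x+25\sin 3x+3\sin 5x\bigr),$$ and let $g,h$ be the $2\pi$-periodic functions such that, for $x\in[-\pi,\pi]$, $g(x)=0$ and $h(x)=\sqrt{1-f(x)^2}$ if $|x|\le \pi/2$, while $g(x)=\sqrt{1-f(x)^2}$ and $h(x)=0$ otherwise. For a continuous $2\pi$-periodic $q:\mathbb R\to\mathbb R$ and a unitary $V$, let $q[V]$ be given by the functional calculus that replaces each spectral value $e^{i\theta}$ of $V$ by $q(\theta)$. For unitary $U,V\in \mathbf M_d(\mathbb C)$ put $$B(U,V)=\begin{pmatrix} f[V] & g[V]+\frac12\{h[V],U\}\\ g[V]+\frac12\{h[V],U^*\} & -f[V]\end{pmatrix},\qquad \{X,Y\}=XY+YX .$$ All norms are operator norms. Let $\eta_q(\delta)$ be the supremum of $\|[q[W],A]\|$ over all $W,A$ in unital $C^*$-algebras with $W$ unitary, $\|A\|\le1$ and $\|[W,A]\|\le\delta$. Put $\beta=2\eta_h+\eta_f$ and $$\rho(\delta)=\sqrt{1-\beta(\delta)},\qquad \mu(\delta)=\inf\{a+b:\ a,b\ge 0,\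 a+\beta(b)\ge\rho(\delta)\},$$ where the square root of a negative number is read as $0$ here and below. Suppose $U,V\in\mathbf M_d(\mathbb C)$ are unitary and $\delta=\|[U,V]\|\le 0.206007$. Then: 1. $B(U,V)$ is Hermitian, $0$ is not in its spectrum, and every $\lambda$ in its spectrum satisfies $|\lambda|\ge\frac{19}{20}\sqrt{1-5\delta}$; indeed $|\lambda|\ge\rho(\delta)\ge\frac{19}{20}\sqrt{1-5\delta}$. 2. If $U_1,V_1\in\mathbf M_d(\mathbb C)$ are unitary and $0$ is in the spectrum of $B(U_1,V_1)$, then $\|U-U_1\|+\|V-V_1\|\ge\frac15\sqrt{1-5\delta}$; indeed $\|U-U_1\|+\|V-V_1\|\ge\mu(\delta)\ge\frac15\sqrt{1-5\delta}$. -/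

import Mathlib

open scoped Matrix.Norms.L2Operator

noncomputable section

namespace LoringBott

/-- The `2π`-periodic function `f(x) = (150 sin x + 25 sin 3x + 3 sin 5x) / 128`. -/
def f (x : ℝ) : ℝ :=
  (150 * Real.sin x + 25 * Real.sin (3 * x) + 3 * Real.sin (5 * x)) / 128

/-- The `2π`-periodic function that is `0` on `[-π/2, π/2]` and `√(1 - f²)` on the rest of
`[-π, π]`. For `x ∈ [-π, π]` one has `x ∈ [-π/2, π/2]` if and only if `0 ≤ cos x`. -/
def g (x : ℝ) : ℝ :=
  if 0 ≤ Real.cos x then 0 else Real.sqrt (1 - f x ^ 2)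

/-- The `2π`-periodic function that is `√(1 - f²)` on `[-π/2, π/2]` and `0` on the rest of
`[-π, π]`. -/
def h (x : ℝ) : ℝ :=
  if 0 ≤ Real.cos x then Real.sqrt (1 - f x ^ 2) else 0

/-- The functional calculus `q[V]` of a unitary `V` at a real, continuous, `2π`-periodic
function `q`: each spectral value `e^{iθ}` of `V` is replaced by `q θ`. -/
def fc {A : Type*} [CStarAlgebra A] (q : ℝ → ℝ) (V : A) : A :=
  cfc (fun z : ℂ => ((q z.arg : ℝ) : ℂ)) V

/-- The block matrix
`B(U,V) = [ f[V], g[V] + ½{h[V],U} ; g[V] + ½{h[V],U*}, -f[V] ]`, with `{X,Y} = XY + YX`. -/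
def B {d : ℕ} (U V : Matrix (Fin d) (Fin d) ℂ) :
    Matrix (Fin d ⊕ Fin d) (Fin d ⊕ Fin d) ℂ :=
  Matrix.fromBlocks
    (fc f V)
    (fc g V + (1 / 2 : ℂ) • (fc h V * U + U * fc h V))
    (fc g V + (1 / 2 : ℂ) • (fc h V * star U + star U * fc h V))
    (-fc f V)

/-- The spectrum of `M` does not meet the open disc of radius `r` about `0`; for Hermitian `M`
this is a spectral gap at `0` of radius at least `r`. -/
def HasGapAtZero {n : Type*} [Fintype n] [DecidableEq n] (M : Matrix n n ℂ) (r : ℝ) : Prop :=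
  ∀ z ∈ spectrum ℂ M, r ≤ ‖z‖

/-- The modulus `η_q(δ)`: the supremum of `‖[q[V], a]‖` over all unital C⋆-algebras `A` and all
`V, a ∈ A` with `V` unitary, `‖a‖ ≤ 1` and `‖[V, a]‖ ≤ δ`. Only the C⋆-subalgebra generated by
`V` and `a` matters; it is separable, hence isomorphic to one in the lowest universe. -/
def eta (q : ℝ → ℝ) (δ : ℝ) : ℝ :=
  sSup {r : ℝ | ∃ (A : Type) (_ : CStarAlgebra A) (V a : A),
    V ∈ unitary A ∧ ‖a‖ ≤ 1 ∧ ‖V * a - a * V‖ ≤ δ ∧ r = ‖fc q V * a - a * fc q V‖}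

/-- `β(δ) = 2 η_h(δ) + η_f(δ)`. -/
def beta (δ : ℝ) : ℝ := 2 * eta h δ + eta f δ

/-- The guaranteed gap radius `√(1 - β(δ))` (read as `0` where `β(δ) > 1`). -/
def gapBound (δ : ℝ) : ℝ := Real.sqrt (1 - beta δ)

/-- The least total displacement `a + b`, with `U` moved by `a` and `V` moved by `b`, for which
the bound `a + β(b)` on the change of `B` reaches the guaranteed gap radius. -/
def moveBound (δ : ℝ) : ℝ :=
  sInf {t : ℝ | ∃ a b : ℝ, 0 ≤ a ∧ 0 ≤ b ∧ t = a + b ∧ gapBound δ ≤ a + beta b}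

end LoringBott

end

/-!
Write `F = f[V]`, `G = g[V]`, `H = h[V]`. These are commuting self-adjoint elements with
`F² + G² + H² = 1` and `G H = 0`, so if `U` commuted with `V` the square of `B(U,V)` would be `1`.
In general, with `E = U H U* - H`, the upper diagonal block of `B(U,V)²` is
`1 + ¼ E² + ½ (E (H - U G) + (H - G U*) E)`; the lower one is the same with `U*` in place of `U`,
and the off-diagonal blocks are `½ {H, [F, U]}` and its adjoint (`diag_block_eq`,
`offDiag_block_eq`). Since `E² ≥ 0` and `‖E‖ = ‖[H, U]‖`, this gives `B² ≥ 1 - (2 η_h + η_f)`,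
which is the gap radius `ρ(δ)`. Moreover `‖H - U G‖² ≤ 1 + 2 ‖[H, U]‖`, so that the factor `2` may
be replaced by `√(1 + 2 η_h)` (`norm_diag_error_le`, `norm_sq_B_apply_ge`); this sharper form is
what excludes `0` from the spectrum up to `δ = 0.206007`.

For the distance estimate, `‖B(U,V) - B(U₁,V₁)‖ ≤ ‖U - U₁‖ + β(‖V - V₁‖)` (`norm_B_sub_le`). Here
`‖q[V] - q[V₁]‖ ≤ η_q(‖V - V₁‖)` follows by applying the commutator estimate to `diag(V, V₁)` and
the block swap (`norm_fc_sub_le`), and `g` is `h` rotated by `π`. A singular `B(U₁,V₁)` is at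
distance at least `ρ(δ)` from `B(U,V)`.

The numerical bounds rest on `η_f(δ) ≤ (15/8) δ` and `η_h(δ) ≤ 1.49 δ + 0.008`. A trigonometric
polynomial `∑ aₖ cos(k x)` has commutator modulus at most `δ ∑ k |aₖ|`, because
`‖[Vᵏ, A]‖ ≤ k ‖[V, A]‖`. The function `f` is such a polynomial in sines, and `h` is within `0.004`
of the explicit polynomial `hApprox` of degree five (`abs_h_sub_hApprox_le`). The small additive
constant is harmless, so no convergence of Fourier series is involved.
-/

noncomputable section

namespace LoringBott

/-! ### The three scalar functions in terms of `sin` and `cos` -/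

lemma f_eq (x : ℝ) :
    f x = (15 * Real.sin x - 10 * Real.sin x ^ 3 + 3 * Real.sin x ^ 5) / 8 := by
  have h5 : Real.sin (5 * x)
      = 16 * Real.sin x ^ 5 - 20 * Real.sin x ^ 3 + 5 * Real.sin x := by
    rw [show 5 * x = 3 * x + 2 * x by ring, Real.sin_add, Real.sin_three_mul, Real.cos_two_mul,
      Real.cos_three_mul, Real.sin_two_mul]
    have hc : Real.cos x ^ 2 = 1 - Real.sin x ^ 2 := Real.cos_sq' x
    have hc4 : Real.cos x ^ 4 = (1 - Real.sin x ^ 2) ^ 2 := by rw [← hc]; ring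
    linear_combination -8 * Real.sin x ^ 3 * hc + 8 * Real.sin x * hc4
  rw [f, h5, Real.sin_three_mul]
  ring

lemma one_sub_f_sq (x : ℝ) :
    1 - f x ^ 2
      = Real.cos x ^ 6 * (40 + 15 * Real.cos x ^ 2 + 9 * Real.cos x ^ 4) / 64 := by
  have hc : Real.cos x ^ 2 = 1 - Real.sin x ^ 2 := Real.cos_sq' x
  rw [f_eq, show Real.cos x ^ 6 = (Real.cos x ^ 2) ^ 3 by ring,
    show Real.cos x ^ 4 = (Real.cos x ^ 2) ^ 2 by ring, hc]
  ring

/-- The profile of `h`: on the circle, `h` is this function of the cosine. -/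
def hProfile (t : ℝ) : ℝ :=
  max t 0 ^ 3 * (Real.sqrt (40 + 15 * t ^ 2 + 9 * t ^ 4) / 8)

lemma hProfile_of_nonpos {t : ℝ} (ht : t ≤ 0) : hProfile t = 0 := by
  simp [hProfile, max_eq_right ht]

lemma continuous_hProfile : Continuous hProfile := by
  unfold hProfile; fun_prop

lemma sqrt_one_sub_f_sq (x : ℝ) : Real.sqrt (1 - f x ^ 2) = hProfile |Real.cos x| := by
  rw [one_sub_f_sq, hProfile, max_eq_left (abs_nonneg _)]
  have h4 : |Real.cos x| ^ 4 = Real.cos x ^ 4 := (even_two_mul 2).pow_abs _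
  have h6 : |Real.cos x| ^ 6 = Real.cos x ^ 6 := (even_two_mul 3).pow_abs _
  rw [h4, sq_abs, Real.sqrt_eq_iff_mul_self_eq (by positivity) (by positivity)]
  have hs : Real.sqrt (40 + 15 * Real.cos x ^ 2 + 9 * Real.cos x ^ 4) ^ 2
      = 40 + 15 * Real.cos x ^ 2 + 9 * Real.cos x ^ 4 := Real.sq_sqrt (by positivity)
  linear_combination -(|Real.cos x| ^ 6 / 64) * hs
    - (40 + 15 * Real.cos x ^ 2 + 9 * Real.cos x ^ 4) / 64 * h6

lemma h_eq (x : ℝ) : h x = hProfile (Real.cos x) := by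
  rw [h]
  split_ifs with hx
  · rw [sqrt_one_sub_f_sq, abs_of_nonneg hx]
  · rw [hProfile_of_nonpos (not_le.mp hx).le]

/-- `g` is `h` shifted by `π`. -/
lemma g_eq (x : ℝ) : g x = hProfile (-Real.cos x) := by
  rw [g]
  split_ifs with hx
  · rw [hProfile_of_nonpos (by linarith)]
  · rw [sqrt_one_sub_f_sq, abs_of_neg (not_le.mp hx)]

lemma f_sq_le_one (x : ℝ) : f x ^ 2 ≤ 1 := by
  have := one_sub_f_sq x
  have : 0 ≤ Real.cos x ^ 6 * (40 + 15 * Real.cos x ^ 2 + 9 * Real.cos x ^ 4) / 64 := by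
    positivity
  linarith

lemma abs_f_le_one (x : ℝ) : |f x| ≤ 1 := (sq_le_one_iff_abs_le_one _).mp (f_sq_le_one x)

lemma f_sq_add_g_sq_add_h_sq (x : ℝ) : f x ^ 2 + g x ^ 2 + h x ^ 2 = 1 := by
  have hs := Real.sq_sqrt (sub_nonneg.mpr (f_sq_le_one x))
  rw [g, h]
  split_ifs <;> simp only [hs] <;> ring

lemma g_mul_h (x : ℝ) : g x * h x = 0 := by
  rw [g, h]
  split_ifs <;> simp

lemma abs_h_le_one (x : ℝ) : |h x| ≤ 1 := by
  rw [← sq_le_one_iff_abs_le_one]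
  nlinarith [f_sq_add_g_sq_add_h_sq x, sq_nonneg (f x), sq_nonneg (g x)]

lemma abs_g_le_one (x : ℝ) : |g x| ≤ 1 := by
  rw [← sq_le_one_iff_abs_le_one]
  nlinarith [f_sq_add_g_sq_add_h_sq x, sq_nonneg (f x), sq_nonneg (h x)]

/-! ### A trigonometric polynomial close to `h` -/

/-- A trigonometric polynomial of degree five: the Fourier partial sum of `h`, with rounded
coefficients. -/
def hApprox (x : ℝ) : ℝ :=
  101 / 500 + (9 / 25 * Real.cos (1 * x) + 2513 / 10000 * Real.cos (2 * x)
    + 33 / 250 * Real.cos (3 * x) + 469 / 10000 * Real.cos (4 * x)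
    + 39 / 5000 * Real.cos (5 * x))

lemma hApprox_eq (x : ℝ) :
    hApprox x = -24 / 10000 + 3 / 1000 * Real.cos x + 1274 / 10000 * Real.cos x ^ 2
      + 372 / 1000 * Real.cos x ^ 3 + 3752 / 10000 * Real.cos x ^ 4
      + 1248 / 10000 * Real.cos x ^ 5 := by
  have h4 : Real.cos (4 * x) = 8 * Real.cos x ^ 4 - 8 * Real.cos x ^ 2 + 1 := by
    rw [show 4 * x = 2 * (2 * x) by ring, Real.cos_two_mul, Real.cos_two_mul]; ring
  have h5 : Real.cos (5 * x) = 16 * Real.cos x ^ 5 - 20 * Real.cos x ^ 3 + 5 * Real.cos x := by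
    rw [show 5 * x = 3 * x + 2 * x by ring, Real.cos_add, Real.sin_three_mul, Real.cos_two_mul,
      Real.cos_three_mul, Real.sin_two_mul]
    have hs : Real.sin x ^ 2 = 1 - Real.cos x ^ 2 := Real.sin_sq x
    have hs4 : Real.sin x ^ 4 = (1 - Real.cos x ^ 2) ^ 2 := by rw [← hs]; ring
    linear_combination -6 * Real.cos x * hs + 8 * Real.cos x * hs4
  rw [hApprox, h4, h5, Real.cos_two_mul, Real.cos_three_mul, one_mul]
  ring

/-- A quadratic approximation on `[0, 1]` of the smooth factor of `hProfile`, as a function of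
the squared cosine. -/
lemma sqrt_weight_approx {c : ℝ} (h0 : 0 ≤ c) (h1 : c ≤ 1) :
    |Real.sqrt (40 + 15 * c + 9 * c ^ 2) / 8
      - (7901 / 10000 + 1559 / 10000 * c + 544 / 10000 * c ^ 2)| ≤ 1 / 2000 := by
  have hs : Real.sqrt (40 + 15 * c + 9 * c ^ 2) ^ 2 = 40 + 15 * c + 9 * c ^ 2 :=
    Real.sq_sqrt (by positivity)
  have hs0 := Real.sqrt_nonneg (40 + 15 * c + 9 * c ^ 2)
  set s := Real.sqrt (40 + 15 * c + 9 * c ^ 2)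
  -- On each subinterval `[a, b]` the Bernstein coefficients of the difference are nonnegative.
  have bern (a b : ℝ) (ha : a ≤ c) (hb : c ≤ b) (i : ℕ) :
      0 ≤ (c - a) ^ i * (b - c) ^ (4 - i) :=
    mul_nonneg (pow_nonneg (sub_nonneg.mpr ha) _) (pow_nonneg (sub_nonneg.mpr hb) _)
  have up : s ^ 2 ≤ (8 * (7906 / 10000 + 1559 / 10000 * c + 544 / 10000 * c ^ 2)) ^ 2 := by
    rw [hs]
    rcases le_total c (1 / 2) with hc | hc
    · have b := bern 0 (1 / 2) h0 hc
      linarith [b 0, b 1, b 2, b 3, b 4]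
    rcases le_total c (3 / 4) with hc' | hc'
    · have b := bern (1 / 2) (3 / 4) hc hc'
      linarith [b 0, b 1, b 2, b 3, b 4]
    · have b := bern (3 / 4) 1 hc' h1
      linarith [b 0, b 1, b 2, b 3, b 4]
  have lo : (8 * (7896 / 10000 + 1559 / 10000 * c + 544 / 10000 * c ^ 2)) ^ 2 ≤ s ^ 2 := by
    rw [hs]
    rcases le_total c (1 / 4) with hc | hc
    · have b := bern 0 (1 / 4) h0 hc
      linarith [b 0, b 1, b 2, b 3, b 4]
    rcases le_total c (1 / 2) with hc' | hc'
    · have b := bern (1 / 4) (1 / 2) hc hc'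
      linarith [b 0, b 1, b 2, b 3, b 4]
    · have b := bern (1 / 2) 1 hc' h1
      linarith [b 0, b 1, b 2, b 3, b 4]
  have up' := abs_le_of_sq_le_sq' up (by positivity)
  have lo' := abs_le_of_sq_le_sq' lo hs0
  rw [abs_le]
  constructor <;> linarith [up'.2, lo'.2]

/-- For negative cosine `h` vanishes and `hApprox` is small. For nonnegative cosine the square root
in `h` is replaced by its quadratic approximation, which leaves a polynomial inequality of degree
seven. -/
lemma abs_h_sub_hApprox_le (x : ℝ) : |h x - hApprox x| ≤ 1 / 250 := by
  rw [h_eq, hApprox_eq]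
  have ht1 := Real.neg_one_le_cos x
  have ht2 := Real.cos_le_one x
  generalize Real.cos x = t at *
  rcases le_total t 0 with ht | ht
  · rw [hProfile_of_nonpos ht, abs_le]
    -- Both bounds are nonnegative combinations of the Bernstein basis on each half.
    have bern (a b : ℝ) (ha : a ≤ t) (hb : t ≤ b) (i : ℕ) :
        0 ≤ (t - a) ^ i * (b - t) ^ (5 - i) :=
      mul_nonneg (pow_nonneg (sub_nonneg.mpr ha) _) (pow_nonneg (sub_nonneg.mpr hb) _)
    rcases le_total t (-1 / 2) with ht' | ht'
    · have b := bern (-1) (-1 / 2) ht1 ht'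
      constructor <;> linarith [b 0, b 1, b 2, b 3, b 4, b 5]
    · have b := bern (-1 / 2) 0 ht' ht
      constructor <;> linarith [b 0, b 1, b 2, b 3, b 4, b 5]
  · have hw := sqrt_weight_approx (sq_nonneg t) (by nlinarith : t ^ 2 ≤ 1)
    rw [hProfile, max_eq_left ht, show t ^ 4 = (t ^ 2) ^ 2 by ring]
    generalize Real.sqrt (40 + 15 * t ^ 2 + 9 * (t ^ 2) ^ 2) / 8 = w at *
    have h3 : t ^ 3 ≤ 1 := pow_le_one₀ ht ht2
    have hd : |t ^ 3 * w
        - t ^ 3 * (7901 / 10000 + 1559 / 10000 * t ^ 2 + 544 / 10000 * (t ^ 2) ^ 2)|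
        ≤ 1 / 2000 := by
      rw [← mul_sub, abs_mul, abs_of_nonneg (by positivity : 0 ≤ t ^ 3)]
      nlinarith [abs_nonneg (w - (7901 / 10000 + 1559 / 10000 * t ^ 2
        + 544 / 10000 * (t ^ 2) ^ 2))]
    have bern (a b : ℝ) (ha : a ≤ t) (hb : t ≤ b) (i : ℕ) :
        0 ≤ (t - a) ^ i * (b - t) ^ (7 - i) :=
      mul_nonneg (pow_nonneg (sub_nonneg.mpr ha) _) (pow_nonneg (sub_nonneg.mpr hb) _)
    rw [abs_le] at hd ⊢
    obtain ⟨hd1, hd2⟩ := hd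
    rcases le_total t (1 / 2) with ht' | ht'
    · have b := bern 0 (1 / 2) ht ht'
      constructor <;> linarith [b 0, b 1, b 2, b 3, b 4, b 5, b 6, b 7]
    · have b := bern (1 / 2) 1 ht' ht2
      constructor <;> linarith [b 0, b 1, b 2, b 3, b 4, b 5, b 6, b 7]

/-! ### Functional calculus of a unitary -/

/-- The function `z ↦ q (arg z)` is continuous on the unit circle, so that `fc q V` is not a
junk value for unitary `V`. -/
def CircleContinuous (q : ℝ → ℝ) : Prop :=
  ContinuousOn (fun z : ℂ => ((q z.arg : ℝ) : ℂ)) (Metric.sphere 0 1)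

lemma cos_arg_of_mem_sphere {z : ℂ} (hz : z ∈ Metric.sphere (0 : ℂ) 1) :
    Real.cos z.arg = z.re := by
  have h1 : ‖z‖ = 1 := by simpa using hz
  simpa [h1] using Complex.norm_mul_cos_arg z

lemma sin_arg_of_mem_sphere {z : ℂ} (hz : z ∈ Metric.sphere (0 : ℂ) 1) :
    Real.sin z.arg = z.im := by
  have h1 : ‖z‖ = 1 := by simpa using hz
  simpa [h1] using Complex.norm_mul_sin_arg z

lemma exp_arg_pow_of_mem_sphere {z : ℂ} (hz : z ∈ Metric.sphere (0 : ℂ) 1) (k : ℕ) :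
    Complex.exp (((k : ℝ) * z.arg : ℝ) * Complex.I) = z ^ k := by
  have h1 : ‖z‖ = 1 := by simpa using hz
  have h2 := Complex.norm_mul_exp_arg_mul_I z
  rw [h1, Complex.ofReal_one, one_mul] at h2
  rw [← h2, ← Complex.exp_nat_mul, h2]
  push_cast
  ring_nf

/-- A continuous function of the cosine is continuous on the circle. -/
lemma circleContinuous_of_cos {q φ : ℝ → ℝ} (hφ : Continuous φ)
    (hq : ∀ x, q x = φ (Real.cos x)) : CircleContinuous q := by
  refine ContinuousOn.congr (f := fun z : ℂ => ((φ z.re : ℝ) : ℂ)) (by fun_prop) fun z hz => ?_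
  simp only [hq, cos_arg_of_mem_sphere hz]

/-- A continuous function of the sine is continuous on the circle. -/
lemma circleContinuous_of_sin {q φ : ℝ → ℝ} (hφ : Continuous φ)
    (hq : ∀ x, q x = φ (Real.sin x)) : CircleContinuous q := by
  refine ContinuousOn.congr (f := fun z : ℂ => ((φ z.im : ℝ) : ℂ)) (by fun_prop) fun z hz => ?_
  simp only [hq, sin_arg_of_mem_sphere hz]

lemma CircleContinuous.add {p q : ℝ → ℝ} (hp : CircleContinuous p) (hq : CircleContinuous q) :
    CircleContinuous (fun x => p x + q x) := by
  unfold CircleContinuous; push_cast; exact ContinuousOn.add hp hq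

lemma CircleContinuous.sub {p q : ℝ → ℝ} (hp : CircleContinuous p) (hq : CircleContinuous q) :
    CircleContinuous (fun x => p x - q x) := by
  unfold CircleContinuous; push_cast; exact ContinuousOn.sub hp hq

lemma CircleContinuous.mul {p q : ℝ → ℝ} (hp : CircleContinuous p) (hq : CircleContinuous q) :
    CircleContinuous (fun x => p x * q x) := by
  unfold CircleContinuous; push_cast; exact ContinuousOn.mul hp hq

lemma circleContinuous_const (c : ℝ) : CircleContinuous (fun _ => c) := continuousOn_const

lemma re_pow_eq_of_mem_sphere {z : ℂ} (hz : z ∈ Metric.sphere (0 : ℂ) 1) (k : ℕ) :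
    Real.cos (k * z.arg) = (z ^ k).re := by
  rw [← exp_arg_pow_of_mem_sphere hz, Complex.exp_ofReal_mul_I_re]

lemma im_pow_eq_of_mem_sphere {z : ℂ} (hz : z ∈ Metric.sphere (0 : ℂ) 1) (k : ℕ) :
    Real.sin (k * z.arg) = (z ^ k).im := by
  rw [← exp_arg_pow_of_mem_sphere hz, Complex.exp_ofReal_mul_I_im]

lemma circleContinuous_cos (k : ℕ) : CircleContinuous (fun x => Real.cos (k * x)) := by
  refine ContinuousOn.congr (f := fun z : ℂ => (((z ^ k).re : ℝ) : ℂ)) (by fun_prop)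
    fun z hz => ?_
  simp only [re_pow_eq_of_mem_sphere hz]

lemma circleContinuous_sin (k : ℕ) : CircleContinuous (fun x => Real.sin (k * x)) := by
  refine ContinuousOn.congr (f := fun z : ℂ => (((z ^ k).im : ℝ) : ℂ)) (by fun_prop)
    fun z hz => ?_
  simp only [im_pow_eq_of_mem_sphere hz]

lemma circleContinuous_f : CircleContinuous f :=
  circleContinuous_of_sin (φ := fun s => (15 * s - 10 * s ^ 3 + 3 * s ^ 5) / 8)
    (by fun_prop) f_eq

lemma circleContinuous_g : CircleContinuous g :=
  circleContinuous_of_cos (φ := fun t => hProfile (-t))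
    (continuous_hProfile.comp continuous_neg) g_eq

lemma circleContinuous_h : CircleContinuous h :=
  circleContinuous_of_cos continuous_hProfile h_eq

section FunctionalCalculus

variable {A : Type*} [CStarAlgebra A] {V : A} {p q : ℝ → ℝ}

lemma CircleContinuous.mono (hq : CircleContinuous q) (hV : V ∈ unitary A) :
    ContinuousOn (fun z : ℂ => ((q z.arg : ℝ) : ℂ)) (spectrum ℂ V) :=
  ContinuousOn.mono hq (spectrum.subset_circle_of_unitary hV)

lemma star_fc (q : ℝ → ℝ) (V : A) : star (fc q V) = fc q V := by
  rw [fc, ← cfc_star]; simp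

lemma fc_add (hV : V ∈ unitary A) (hp : CircleContinuous p) (hq : CircleContinuous q) :
    fc (fun x => p x + q x) V = fc p V + fc q V := by
  simp only [fc, Complex.ofReal_add]
  exact cfc_add _ _ _ (hp.mono hV) (hq.mono hV)

lemma fc_mul (hV : V ∈ unitary A) (hp : CircleContinuous p) (hq : CircleContinuous q) :
    fc (fun x => p x * q x) V = fc p V * fc q V := by
  simp only [fc, Complex.ofReal_mul]
  exact cfc_mul _ _ _ (hp.mono hV) (hq.mono hV)

lemma fc_const_mul (hV : V ∈ unitary A) (c : ℝ) (hq : CircleContinuous q) :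
    fc (fun x => c * q x) V = (c : ℂ) • fc q V := by
  simp only [fc, Complex.ofReal_mul]
  exact cfc_const_mul _ _ _ (hq.mono hV)

lemma fc_const (hV : V ∈ unitary A) (c : ℝ) : fc (fun _ => c) V = algebraMap ℂ A c := by
  have : IsStarNormal V := ⟨by rw [Commute, SemiconjBy, hV.1, hV.2]⟩
  exact cfc_const _ _

lemma commute_fc (p q : ℝ → ℝ) (V : A) : fc p V * fc q V = fc q V * fc p V :=
  cfc_commute_cfc _ _ _

lemma norm_fc_le {c : ℝ} (hc : 0 ≤ c) (hq : ∀ x, |q x| ≤ c) (V : A) : ‖fc q V‖ ≤ c :=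
  norm_cfc_le hc fun z _ => by simpa using hq z.arg

lemma fc_cos (hV : V ∈ unitary A) (k : ℕ) :
    fc (fun x => Real.cos (k * x)) V = (1 / 2 : ℂ) • (V ^ k + star V ^ k) := by
  have hn : IsStarNormal V := ⟨by rw [Commute, SemiconjBy, hV.1, hV.2]⟩
  have : fc (fun x => Real.cos (k * x)) V
      = cfc (fun z : ℂ => (1 / 2 : ℂ) * (z ^ k + star z ^ k)) V := by
    refine cfc_congr fun z hz => ?_
    simp only [re_pow_eq_of_mem_sphere (spectrum.subset_circle_of_unitary hV hz)]
    rw [Complex.re_eq_add_conj, map_pow, Complex.star_def]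
    ring
  rw [this, cfc_const_mul _ _ _ (by fun_prop), cfc_add _ _ _ (by fun_prop) (by fun_prop),
    cfc_pow_id V k, cfc_pow _ _ V (by fun_prop), cfc_star_id V]

lemma fc_sin (hV : V ∈ unitary A) (k : ℕ) :
    fc (fun x => Real.sin (k * x)) V = (1 / (2 * Complex.I) : ℂ) • (V ^ k - star V ^ k) := by
  have hn : IsStarNormal V := ⟨by rw [Commute, SemiconjBy, hV.1, hV.2]⟩
  have : fc (fun x => Real.sin (k * x)) V
      = cfc (fun z : ℂ => (1 / (2 * Complex.I) : ℂ) * (z ^ k - star z ^ k)) V := by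
    refine cfc_congr fun z hz => ?_
    simp only [im_pow_eq_of_mem_sphere (spectrum.subset_circle_of_unitary hV hz)]
    rw [Complex.im_eq_sub_conj, map_pow, Complex.star_def]
    ring
  rw [this, cfc_const_mul _ _ _ (by fun_prop), cfc_sub _ _ _ (by fun_prop) (by fun_prop),
    cfc_pow_id V k, cfc_pow _ _ V (by fun_prop), cfc_star_id V]

/-- Rotating the circle by `π` exchanges `g` and `h`. -/
lemma fc_g_eq_fc_h_neg (hV : V ∈ unitary A) : fc g V = fc h (-V) := by
  have hn : IsStarNormal V := ⟨by rw [Commute, SemiconjBy, hV.1, hV.2]⟩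
  have hV' : -V ∈ unitary A := by
    rw [Unitary.mem_iff] at hV ⊢; simpa using hV
  have hc := circleContinuous_h.mono hV'
  rw [fc, fc, ← cfc_comp_neg (fun z : ℂ => ((h z.arg : ℝ) : ℂ)) V (by
    rwa [Set.image_neg_eq_neg, spectrum.neg_eq])]
  refine cfc_congr fun z hz => ?_
  have hz1 := spectrum.subset_circle_of_unitary hV hz
  have hz2 : -z ∈ Metric.sphere (0 : ℂ) 1 := by simpa using hz1
  simp only [g_eq, h_eq, cos_arg_of_mem_sphere hz1, cos_arg_of_mem_sphere hz2, Complex.neg_re]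

/-! ### Norms of commutators -/

lemma norm_le_one_of_mem_unitary (hV : V ∈ unitary A) : ‖V‖ ≤ 1 := by
  obtain _ | _ := subsingleton_or_nontrivial A
  · simp [Subsingleton.elim V 0]
  · exact (CStarRing.norm_of_mem_unitary hV).le

lemma norm_comm_add_le (X Y a : A) :
    ‖(X + Y) * a - a * (X + Y)‖ ≤ ‖X * a - a * X‖ + ‖Y * a - a * Y‖ := by
  rw [show (X + Y) * a - a * (X + Y) = (X * a - a * X) + (Y * a - a * Y) by noncomm_ring]
  exact norm_add_le _ _

lemma norm_comm_smul (c : ℂ) (X a : A) :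
    ‖(c • X) * a - a * (c • X)‖ = ‖c‖ * ‖X * a - a * X‖ := by
  rw [smul_mul_assoc, mul_smul_comm, ← smul_sub, norm_smul]

lemma norm_comm_le (X a : A) : ‖X * a - a * X‖ ≤ 2 * ‖X‖ * ‖a‖ := by
  have h1 := norm_mul_le X a
  have h2 := norm_mul_le a X
  linarith [norm_sub_le (X * a) (a * X)]

lemma norm_comm_pow_le {X : A} (hX : ‖X‖ ≤ 1) (a : A) (k : ℕ) :
    ‖X ^ k * a - a * X ^ k‖ ≤ k * ‖X * a - a * X‖ := by
  have hk : ∀ k : ℕ, ‖X ^ k‖ ≤ 1 := fun k => by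
    induction k with
    | zero =>
      rw [pow_zero]
      exact norm_le_one_of_mem_unitary (one_mem (unitary A))
    | succ k ih =>
      rw [pow_succ]
      exact (norm_mul_le _ _).trans (mul_le_one₀ ih (norm_nonneg _) hX)
  induction k with
  | zero => simp
  | succ k ih =>
    rw [show X ^ (k + 1) * a - a * X ^ (k + 1)
      = X ^ k * (X * a - a * X) + (X ^ k * a - a * X ^ k) * X by rw [pow_succ]; noncomm_ring]
    have h1 := norm_mul_le (X ^ k) (X * a - a * X)
    have h2 := norm_mul_le (X ^ k * a - a * X ^ k) X
    have h3 := mul_le_mul_of_nonneg_right (hk k) (norm_nonneg (X * a - a * X))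
    have h4 := mul_le_mul_of_nonneg_left hX (norm_nonneg (X ^ k * a - a * X ^ k))
    have h5 := norm_add_le (X ^ k * (X * a - a * X)) ((X ^ k * a - a * X ^ k) * X)
    push_cast
    linarith

lemma norm_comm_star_le (hV : V ∈ unitary A) (a : A) :
    ‖star V * a - a * star V‖ ≤ ‖V * a - a * V‖ := by
  have e : star V * a - a * star V = -(star V * (V * a - a * V) * star V) := by
    calc star V * a - a * star V
        = star V * a * (V * star V) - (star V * V) * a * star V := by
          rw [hV.1, hV.2]; noncomm_ring
      _ = _ := by noncomm_ring
  rw [e, norm_neg, CStarRing.norm_mul_mem_unitary _ (Unitary.star_mem hV),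
    CStarRing.norm_mem_unitary_mul _ (Unitary.star_mem hV)]

lemma norm_comm_star_pow_le (hV : V ∈ unitary A) (a : A) (k : ℕ) :
    ‖star V ^ k * a - a * star V ^ k‖ ≤ k * ‖V * a - a * V‖ :=
  (norm_comm_pow_le (norm_le_one_of_mem_unitary (Unitary.star_mem hV)) a k).trans
    (mul_le_mul_of_nonneg_left (norm_comm_star_le hV a) k.cast_nonneg)

lemma norm_comm_fc_cos_le (hV : V ∈ unitary A) (a : A) (k : ℕ) :
    ‖fc (fun x => Real.cos (k * x)) V * a - a * fc (fun x => Real.cos (k * x)) V‖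
      ≤ k * ‖V * a - a * V‖ := by
  rw [fc_cos hV, norm_comm_smul]
  have h1 := norm_comm_add_le (V ^ k) (star V ^ k) a
  have h2 := norm_comm_pow_le (norm_le_one_of_mem_unitary hV) a k
  have h3 := norm_comm_star_pow_le hV a k
  norm_num
  linarith

lemma norm_comm_fc_sin_le (hV : V ∈ unitary A) (a : A) (k : ℕ) :
    ‖fc (fun x => Real.sin (k * x)) V * a - a * fc (fun x => Real.sin (k * x)) V‖
      ≤ k * ‖V * a - a * V‖ := by
  rw [fc_sin hV, norm_comm_smul]
  have h1 := norm_comm_add_le (V ^ k) (-star V ^ k) a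
  have h2 := norm_comm_pow_le (norm_le_one_of_mem_unitary hV) a k
  have h3 := norm_comm_star_pow_le hV a k
  rw [← norm_neg, show -(star V ^ k * a - a * star V ^ k)
    = -star V ^ k * a - a * -star V ^ k by noncomm_ring] at h3
  rw [← sub_eq_add_neg] at h1
  norm_num
  linarith

lemma norm_comm_fc_add_le (hV : V ∈ unitary A) (a : A) (hp : CircleContinuous p)
    (hq : CircleContinuous q) :
    ‖fc (fun x => p x + q x) V * a - a * fc (fun x => p x + q x) V‖
      ≤ ‖fc p V * a - a * fc p V‖ + ‖fc q V * a - a * fc q V‖ := by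
  rw [fc_add hV hp hq]
  exact norm_comm_add_le _ _ _

lemma norm_comm_fc_const_mul_cos_le (hV : V ∈ unitary A) (a : A) {c : ℝ} (hc : 0 ≤ c) (k : ℕ)
    {r : ℝ} (hr : r = k) :
    ‖fc (fun x => c * Real.cos (r * x)) V * a - a * fc (fun x => c * Real.cos (r * x)) V‖
      ≤ c * r * ‖V * a - a * V‖ := by
  subst hr
  rw [fc_const_mul hV c (circleContinuous_cos k), norm_comm_smul, Complex.norm_real,
    Real.norm_of_nonneg hc, mul_assoc]
  exact mul_le_mul_of_nonneg_left (norm_comm_fc_cos_le hV a k) hc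

lemma norm_comm_fc_const_mul_sin_le (hV : V ∈ unitary A) (a : A) {c : ℝ} (hc : 0 ≤ c) (k : ℕ)
    {r : ℝ} (hr : r = k) :
    ‖fc (fun x => c * Real.sin (r * x)) V * a - a * fc (fun x => c * Real.sin (r * x)) V‖
      ≤ c * r * ‖V * a - a * V‖ := by
  subst hr
  rw [fc_const_mul hV c (circleContinuous_sin k), norm_comm_smul, Complex.norm_real,
    Real.norm_of_nonneg hc, mul_assoc]
  exact mul_le_mul_of_nonneg_left (norm_comm_fc_sin_le hV a k) hc

lemma circleContinuous_const_mul_cos (c : ℝ) (k : ℕ) {r : ℝ} (hr : r = k) :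
    CircleContinuous (fun x => c * Real.cos (r * x)) :=
  hr ▸ (circleContinuous_const c).mul (circleContinuous_cos k)

lemma circleContinuous_const_mul_sin (c : ℝ) (k : ℕ) {r : ℝ} (hr : r = k) :
    CircleContinuous (fun x => c * Real.sin (r * x)) :=
  hr ▸ (circleContinuous_const c).mul (circleContinuous_sin k)

/-- The constant is `(150 + 3 * 25 + 5 * 3) / 128`. -/
lemma norm_comm_fc_f_le (hV : V ∈ unitary A) (a : A) :
    ‖fc f V * a - a * fc f V‖ ≤ 15 / 8 * ‖V * a - a * V‖ := by
  have e : f = fun x => 150 / 128 * Real.sin (1 * x)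
      + (25 / 128 * Real.sin (3 * x) + 3 / 128 * Real.sin (5 * x)) := by
    funext x; rw [f, one_mul]; ring
  have c1 := circleContinuous_const_mul_sin (150 / 128) 1 (r := 1) (by norm_num)
  have c3 := circleContinuous_const_mul_sin (25 / 128) 3 (r := 3) (by norm_num)
  have c5 := circleContinuous_const_mul_sin (3 / 128) 5 (r := 5) (by norm_num)
  have h1 := norm_comm_fc_const_mul_sin_le hV a (c := 150 / 128) (by norm_num) 1 (r := 1)
    (by norm_num)
  have h3 := norm_comm_fc_const_mul_sin_le hV a (c := 25 / 128) (by norm_num) 3 (r := 3)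
    (by norm_num)
  have h5 := norm_comm_fc_const_mul_sin_le hV a (c := 3 / 128) (by norm_num) 5 (r := 5)
    (by norm_num)
  have i1 := norm_comm_fc_add_le hV a c3 c5
  have i2 := norm_comm_fc_add_le hV a c1 (c3.add c5)
  rw [← e] at i2
  linarith

/-- The sum of `k |aₖ|` over the coefficients `aₖ` of `hApprox` is `1.4852`. -/
lemma circleContinuous_hApprox_and_norm_comm_le (hV : V ∈ unitary A) (a : A) :
    CircleContinuous hApprox ∧
      ‖fc hApprox V * a - a * fc hApprox V‖ ≤ 149 / 100 * ‖V * a - a * V‖ := by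
  have c0 := circleContinuous_const (101 / 500)
  have c1 := circleContinuous_const_mul_cos (9 / 25) 1 (r := 1) (by norm_num)
  have c2 := circleContinuous_const_mul_cos (2513 / 10000) 2 (r := 2) (by norm_num)
  have c3 := circleContinuous_const_mul_cos (33 / 250) 3 (r := 3) (by norm_num)
  have c4 := circleContinuous_const_mul_cos (469 / 10000) 4 (r := 4) (by norm_num)
  have c5 := circleContinuous_const_mul_cos (39 / 5000) 5 (r := 5) (by norm_num)
  have h1 := norm_comm_fc_const_mul_cos_le hV a (c := 9 / 25) (by norm_num) 1 (r := 1)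
    (by norm_num)
  have h2 := norm_comm_fc_const_mul_cos_le hV a (c := 2513 / 10000) (by norm_num) 2 (r := 2)
    (by norm_num)
  have h3 := norm_comm_fc_const_mul_cos_le hV a (c := 33 / 250) (by norm_num) 3 (r := 3)
    (by norm_num)
  have h4 := norm_comm_fc_const_mul_cos_le hV a (c := 469 / 10000) (by norm_num) 4 (r := 4)
    (by norm_num)
  have h5 := norm_comm_fc_const_mul_cos_le hV a (c := 39 / 5000) (by norm_num) 5 (r := 5)
    (by norm_num)
  have h0 : ‖fc (fun _ => 101 / 500) V * a - a * fc (fun _ => 101 / 500) V‖ = 0 := by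
    rw [fc_const hV, Algebra.commutes, sub_self, norm_zero]
  have i1 := norm_comm_fc_add_le hV a c1 c2
  have i2 := norm_comm_fc_add_le hV a (c1.add c2) c3
  have i3 := norm_comm_fc_add_le hV a ((c1.add c2).add c3) c4
  have i4 := norm_comm_fc_add_le hV a (((c1.add c2).add c3).add c4) c5
  have i5 := norm_comm_fc_add_le hV a c0 ((((c1.add c2).add c3).add c4).add c5)
  refine ⟨c0.add ((((c1.add c2).add c3).add c4).add c5), ?_⟩
  change ‖fc hApprox V * a - a * fc hApprox V‖ ≤ _ at i5
  linarith [norm_nonneg (V * a - a * V)]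

/-- The trigonometric polynomial `hApprox` contributes the Lipschitz term, and the uniform
distance `1 / 250` from it to `h` contributes the additive constant. -/
lemma norm_comm_fc_h_le (hV : V ∈ unitary A) {a : A} (ha : ‖a‖ ≤ 1) :
    ‖fc h V * a - a * fc h V‖ ≤ 149 / 100 * ‖V * a - a * V‖ + 1 / 125 := by
  obtain ⟨hc, hle⟩ := circleContinuous_hApprox_and_norm_comm_le hV a
  have hr : ‖fc (fun x => h x - hApprox x) V‖ ≤ 1 / 250 :=
    norm_fc_le (by norm_num) abs_h_sub_hApprox_le V
  have h1 := norm_comm_fc_add_le hV a hc (circleContinuous_h.sub hc)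
  have e : (fun x => hApprox x + (h x - hApprox x)) = h := by funext x; ring
  rw [e] at h1
  have h2 := norm_comm_le (fc (fun x => h x - hApprox x) V) a
  have h3 : 2 * ‖fc (fun x => h x - hApprox x) V‖ * ‖a‖ ≤ 2 * (1 / 250) * 1 := by gcongr
  linarith

end FunctionalCalculus

/-! ### The moduli `η` -/

lemma le_eta {q : ℝ → ℝ} (hq : ∀ x, |q x| ≤ 1) {A : Type} [CStarAlgebra A] {V a : A} {δ : ℝ}
    (hV : V ∈ unitary A) (ha : ‖a‖ ≤ 1) (hδ : ‖V * a - a * V‖ ≤ δ) :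
    ‖fc q V * a - a * fc q V‖ ≤ eta q δ := by
  -- The supremum is over a set bounded by `2`, since `‖q[V]‖ ≤ 1`.
  refine le_csSup ⟨2, ?_⟩ ⟨A, _, V, a, hV, ha, hδ, rfl⟩
  rintro r ⟨A', _, V', a', _, ha', _, rfl⟩
  have h1 := norm_fc_le zero_le_one hq V'
  calc _ ≤ 2 * ‖fc q V'‖ * ‖a'‖ := norm_comm_le _ _
    _ ≤ 2 * 1 * 1 := by gcongr
    _ = 2 := by norm_num

lemma eta_f_le {δ : ℝ} (hδ : 0 ≤ δ) : eta f δ ≤ 15 / 8 * δ := by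
  refine Real.sSup_le ?_ (by positivity)
  rintro r ⟨A, _, V, a, hV, -, hc, rfl⟩
  exact (norm_comm_fc_f_le hV a).trans (by gcongr)

lemma eta_h_le {δ : ℝ} (hδ : 0 ≤ δ) : eta h δ ≤ 149 / 100 * δ + 1 / 125 := by
  refine Real.sSup_le ?_ (by positivity)
  rintro r ⟨A, _, V, a, hV, ha, hc, rfl⟩
  exact (norm_comm_fc_h_le hV ha).trans (by gcongr)

/-- The coefficients are `2 * 1.49 + 1.875` and `2 * 0.008`. -/
lemma beta_le {δ : ℝ} (hδ : 0 ≤ δ) : beta δ ≤ 971 / 200 * δ + 2 / 125 := by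
  rw [beta]
  linarith [eta_f_le hδ, eta_h_le hδ]

lemma sq_gapBound_ge {δ : ℝ} (h0 : 0 ≤ δ) : 1 - (971 / 200 * δ + 2 / 125) ≤ gapBound δ ^ 2 := by
  rw [gapBound]
  rcases le_total 0 (1 - beta δ) with hb | hb
  · rw [Real.sq_sqrt hb]; linarith [beta_le h0]
  · linarith [beta_le h0, sq_nonneg (Real.sqrt (1 - beta δ))]

lemma sqrt_le_gapBound {δ : ℝ} (h0 : 0 ≤ δ) :
    19 / 20 * Real.sqrt (1 - 5 * δ) ≤ gapBound δ := by
  have hg : 0 ≤ gapBound δ := Real.sqrt_nonneg _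
  rcases le_total (1 - 5 * δ) 0 with h1 | h1
  · rwa [Real.sqrt_eq_zero_of_nonpos h1, mul_zero]
  · refine le_of_sq_le_sq ?_ hg
    rw [mul_pow, Real.sq_sqrt h1]
    linarith [sq_gapBound_ge h0]

/-- With `s = √(1 - 5δ)`, the bound `β(δ) ≤ 4.855 δ + 0.016` gives `ρ(δ)² ≥ 0.013 + 0.971 s²`,
hence `ρ(δ) ≥ 0.971 s + 0.016`; so `ρ(δ) ≤ a + β(b)` forces `a + 4.855 b ≥ 0.971 s`. -/
lemma sqrt_le_moveBound {δ : ℝ} (h0 : 0 ≤ δ) :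
    1 / 5 * Real.sqrt (1 - 5 * δ) ≤ moveBound δ := by
  -- The set is nonempty: `b = 0` and a large `a` belong to it.
  refine le_csInf ⟨_, gapBound δ + |beta 0|, 0,
    add_nonneg (Real.sqrt_nonneg _) (abs_nonneg _), le_rfl, rfl, ?_⟩ ?_
  · linarith [neg_abs_le (beta 0)]
  rintro t ⟨a, b, ha, hb, rfl, hab⟩
  have hg : 0 ≤ gapBound δ := Real.sqrt_nonneg _
  rcases le_total (1 - 5 * δ) 0 with h1 | h1
  · rw [Real.sqrt_eq_zero_of_nonpos h1]; linarith
  have hs := Real.sq_sqrt h1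
  set s := Real.sqrt (1 - 5 * δ)
  have hs0 : 0 ≤ s := Real.sqrt_nonneg _
  have h2 := sq_gapBound_ge h0
  have h3 : 971 / 1000 * s + 2 / 125 ≤ gapBound δ := by
    refine le_of_sq_le_sq ?_ hg
    nlinarith [sq_nonneg (s - 1 / 2)]
  have h4 := beta_le hb
  linarith

/-! ### The square of the block matrix -/

section CStar

variable {A : Type*} [CStarAlgebra A]

/-- The excess of a diagonal block of `B²` over `1` is a positive term plus `½(E Z + Z* E)`,
where `E = U H U* - H` and `Z = H - U G`. -/
lemma diag_block_eq {F G H U : A} (hU : U ∈ unitary A) (hGH : G * H = 0) (hHG : H * G = 0)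
    (h1 : F * F + G * G + H * H = 1) :
    F * F + (G + (1 / 2 : ℂ) • (H * U + U * H)) * (G + (1 / 2 : ℂ) • (H * star U + star U * H))
      = 1 + ((1 / 2 : ℂ) • (U * H * star U - H)) * ((1 / 2 : ℂ) • (U * H * star U - H))
        + (1 / 2 : ℂ) • ((U * H * star U - H) * (H - U * G)
          + (H - G * star U) * (U * H * star U - H)) := by
  have hl' (x : A) : star U * (U * x) = x := by rw [← mul_assoc, hU.1, one_mul]
  have hr' (x : A) : U * (star U * x) = x := by rw [← mul_assoc, hU.2, one_mul]
  have hGH' (x : A) : G * (H * x) = 0 := by rw [← mul_assoc, hGH, zero_mul]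
  rw [← h1]
  simp only [mul_add, add_mul, mul_sub, sub_mul, smul_mul_assoc, mul_smul_comm, smul_add,
    smul_sub, mul_assoc, hl', hr', hHG, hGH', mul_zero, smul_zero]
  module

lemma offDiag_block_eq {F G H U : A} (hFG : F * G = G * F) (hFH : F * H = H * F) :
    F * (G + (1 / 2 : ℂ) • (H * U + U * H)) - (G + (1 / 2 : ℂ) • (H * U + U * H)) * F
      = (1 / 2 : ℂ) • (H * (F * U - U * F) + (F * U - U * F) * H) := by
  have hFH' (x : A) : F * (H * x) = H * (F * x) := by rw [← mul_assoc, hFH, mul_assoc]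
  simp only [mul_add, add_mul, mul_sub, sub_mul, smul_mul_assoc, mul_smul_comm, smul_add,
    smul_sub, mul_assoc, hFG, hFH, hFH']
  module

lemma norm_half_smul_add_le {X Y : A} {c : ℝ} (hX : ‖X‖ ≤ c) (hY : ‖Y‖ ≤ c) :
    ‖(1 / 2 : ℂ) • (X + Y)‖ ≤ c := by
  rw [norm_smul]
  norm_num
  linarith [norm_add_le X Y]

/-- The bound on the error `½(E Z + Z* E)` of a diagonal block: `‖E‖ = ‖[H, U]‖`, and
`Z* Z = G² + H² - (H U G + G U* H)` with `H U G = [H, U] G`. -/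
lemma norm_diag_error_le {G H U : A} (hU : U ∈ unitary A) (hG : star G = G) (hH : star H = H)
    (hG1 : ‖G‖ ≤ 1) (hH1 : ‖H‖ ≤ 1) (hHG : H * G = 0)
    (hsq : ‖G * G + H * H‖ ≤ 1) {e : ℝ} (he : ‖H * U - U * H‖ ≤ e) :
    ‖(1 / 2 : ℂ) • ((U * H * star U - H) * (H - U * G)
        + (H - G * star U) * (U * H * star U - H))‖ ≤ e * min 2 (Real.sqrt (1 + 2 * e)) := by
  have hE : ‖U * H * star U - H‖ ≤ e := by
    have : U * H * star U - H = -((H * U - U * H) * star U) := by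
      rw [sub_mul, mul_assoc H, hU.2, mul_one]; abel
    rw [this, norm_neg, CStarRing.norm_mul_mem_unitary _ (Unitary.star_mem hU)]
    exact he
  have hZs : star (H - U * G) = H - G * star U := by rw [star_sub, star_mul, hH, hG]
  have hZn : ‖H - G * star U‖ = ‖H - U * G‖ := by rw [← hZs, norm_star]
  have he0 : 0 ≤ e := (norm_nonneg _).trans he
  have hZ : ‖H - U * G‖ ≤ min 2 (Real.sqrt (1 + 2 * e)) := by
    refine le_min ?_ (Real.le_sqrt_of_sq_le ?_)
    · have := norm_sub_le H (U * G)
      rw [CStarRing.norm_mem_unitary_mul _ hU] at this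
      linarith
    · have hZZ : (H - G * star U) * (H - U * G)
          = (G * G + H * H) - ((H * U - U * H) * G + star ((H * U - U * H) * G)) := by
        have hl' (x : A) : star U * (U * x) = x := by rw [← mul_assoc, hU.1, one_mul]
        simp only [star_mul, star_sub, hG, hH, mul_sub, sub_mul, mul_assoc, hl', hHG,
          mul_zero, star_zero]
        abel
      have hX : ‖(H * U - U * H) * G‖ ≤ e :=
        (norm_mul_le _ _).trans
          ((mul_le_mul he hG1 (norm_nonneg _) he0).trans (mul_one e).le)
      rw [sq, ← CStarRing.norm_star_mul_self, hZs, hZZ]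
      have h2 := norm_add_le ((H * U - U * H) * G) (star ((H * U - U * H) * G))
      rw [norm_star] at h2
      linarith [norm_sub_le (G * G + H * H)
        ((H * U - U * H) * G + star ((H * U - U * H) * G))]
  refine norm_half_smul_add_le ((norm_mul_le _ _).trans ?_) ((norm_mul_le _ _).trans ?_)
  · gcongr
  · rw [hZn, mul_comm]
    gcongr

lemma norm_comm_star_right {X U : A} (hX : star X = X) :
    ‖X * star U - star U * X‖ = ‖X * U - U * X‖ := by
  rw [← norm_star, star_sub, star_mul, star_mul, hX, star_star, norm_sub_rev]

lemma norm_half_smul_anticomm_le {X Y : A} {c : ℝ} (hX : ‖X‖ ≤ 1) (hY : ‖Y‖ ≤ c) :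
    ‖(1 / 2 : ℂ) • (X * Y + Y * X)‖ ≤ c := by
  have hc : 0 ≤ c := (norm_nonneg _).trans hY
  refine norm_half_smul_add_le ((norm_mul_le _ _).trans ?_) ((norm_mul_le _ _).trans ?_)
  · exact (mul_le_mul hX hY (norm_nonneg _) zero_le_one).trans (one_mul c).le
  · exact (mul_le_mul hY hX (norm_nonneg _) hc).trans (mul_one c).le

lemma star_half_smul_conj_sub {H U : A} (hH : star H = H) :
    star ((1 / 2 : ℂ) • (U * H * star U - H)) = (1 / 2 : ℂ) • (U * H * star U - H) := by
  rw [star_smul, star_sub, star_mul, star_mul, star_star, hH, mul_assoc]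
  simp

end CStar

/-! ### Norms of block matrices -/

lemma star_fromBlocks {n : Type*} (X Y Z W : Matrix n n ℂ) :
    star (Matrix.fromBlocks X Y Z W)
      = Matrix.fromBlocks (star X) (star Z) (star Y) (star W) :=
  Matrix.fromBlocks_conjTranspose X Y Z W

lemma fromBlocks_sub {n : Type*} (X Y Z W X' Y' Z' W' : Matrix n n ℂ) :
    Matrix.fromBlocks X Y Z W - Matrix.fromBlocks X' Y' Z' W'
      = Matrix.fromBlocks (X - X') (Y - Y') (Z - Z') (W - W') := by
  ext (i | i) (j | j) <;> rfl

variable {n : Type*} [Fintype n] [DecidableEq n]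

/-- Two matrices as the diagonal blocks of one, as a homomorphism of C⋆-algebras. -/
def blockDiag :
    (Matrix n n ℂ × Matrix n n ℂ) →⋆ₐ[ℂ] Matrix (n ⊕ n) (n ⊕ n) ℂ where
  toFun p := Matrix.fromBlocks p.1 0 0 p.2
  map_one' := Matrix.fromBlocks_one
  map_zero' := Matrix.fromBlocks_zero
  map_mul' p q := by simp [Matrix.fromBlocks_multiply]
  map_add' p q := by simp [Matrix.fromBlocks_add]
  commutes' r := by
    simp only [Algebra.algebraMap_eq_smul_one, Prod.smul_fst, Prod.smul_snd, Prod.fst_one,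
      Prod.snd_one]
    rw [← Matrix.fromBlocks_one, Matrix.fromBlocks_smul, smul_zero]
  map_star' p := by
    simp [Matrix.star_eq_conjTranspose, Matrix.fromBlocks_conjTranspose]

lemma norm_fromBlocks_diag_le {X Y : Matrix n n ℂ} {c : ℝ} (hX : ‖X‖ ≤ c) (hY : ‖Y‖ ≤ c) :
    ‖Matrix.fromBlocks X 0 0 Y‖ ≤ c := by
  have h1 := NonUnitalStarAlgHom.norm_apply_le (blockDiag (n := n)) (X, Y)
  exact h1.trans (max_le hX hY)

lemma norm_le_norm_fromBlocks_diag (X Y : Matrix n n ℂ) :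
    ‖X‖ ≤ ‖Matrix.fromBlocks X 0 0 Y‖ := by
  have hinj : Function.Injective (blockDiag (n := n)) := fun p q hpq => by
    have := Matrix.fromBlocks_inj.mp hpq
    exact Prod.ext this.1 this.2.2.2
  have h1 := NonUnitalStarAlgHom.norm_map (blockDiag (n := n)) hinj (X, Y)
  exact (le_max_left ‖X‖ ‖Y‖).trans h1.ge

lemma swap_mem_unitary :
    (Matrix.fromBlocks 0 1 1 0 : Matrix (n ⊕ n) (n ⊕ n) ℂ)
      ∈ unitary (Matrix (n ⊕ n) (n ⊕ n) ℂ) := by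
  rw [Unitary.mem_iff]
  simp [Matrix.star_eq_conjTranspose, Matrix.fromBlocks_conjTranspose,
    Matrix.fromBlocks_multiply]

lemma norm_fromBlocks_offDiag_le {X Y : Matrix n n ℂ} {c : ℝ} (hX : ‖X‖ ≤ c) (hY : ‖Y‖ ≤ c) :
    ‖Matrix.fromBlocks 0 X Y 0‖ ≤ c := by
  have e : Matrix.fromBlocks 0 X Y 0
      = Matrix.fromBlocks X 0 0 Y * Matrix.fromBlocks 0 1 1 0 := by
    simp [Matrix.fromBlocks_multiply]
  rw [e]
  exact (CStarRing.norm_mul_mem_unitary (Matrix.fromBlocks X 0 0 Y) swap_mem_unitary).le.trans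
    (norm_fromBlocks_diag_le hX hY)

lemma norm_le_norm_fromBlocks_offDiag (X Y : Matrix n n ℂ) :
    ‖X‖ ≤ ‖Matrix.fromBlocks 0 X Y 0‖ := by
  have e : Matrix.fromBlocks X 0 0 Y
      = Matrix.fromBlocks 0 X Y 0 * Matrix.fromBlocks 0 1 1 0 := by
    simp [Matrix.fromBlocks_multiply]
  refine (norm_le_norm_fromBlocks_diag X Y).trans ?_
  rw [e]
  exact (CStarRing.norm_mul_mem_unitary (Matrix.fromBlocks 0 X Y 0) swap_mem_unitary).le

lemma blockDiag_mem_unitary {V W : Matrix n n ℂ} (hV : V ∈ unitary (Matrix n n ℂ))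
    (hW : W ∈ unitary (Matrix n n ℂ)) :
    Matrix.fromBlocks V 0 0 W ∈ unitary (Matrix (n ⊕ n) (n ⊕ n) ℂ) := by
  rw [Unitary.mem_iff] at hV hW ⊢
  simp only [Matrix.star_eq_conjTranspose] at *
  simp [Matrix.fromBlocks_conjTranspose, Matrix.fromBlocks_multiply, hV, hW]

lemma fc_fromBlocks_diag {q : ℝ → ℝ} (hq : CircleContinuous q) {V W : Matrix n n ℂ}
    (hV : V ∈ unitary (Matrix n n ℂ)) (hW : W ∈ unitary (Matrix n n ℂ)) :
    fc q (Matrix.fromBlocks V 0 0 W) = Matrix.fromBlocks (fc q V) 0 0 (fc q W) := by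
  have hVW : (V, W) ∈ unitary (Matrix n n ℂ × Matrix n n ℂ) :=
    ⟨Prod.ext hV.1 hW.1, Prod.ext hV.2 hW.2⟩
  have hBl := blockDiag_mem_unitary hV hW
  have i1 : IsStarNormal V := ⟨by rw [Commute, SemiconjBy, hV.1, hV.2]⟩
  have i2 : IsStarNormal W := ⟨by rw [Commute, SemiconjBy, hW.1, hW.2]⟩
  have i3 : IsStarNormal (V, W) := ⟨by rw [Commute, SemiconjBy, hVW.1, hVW.2]⟩
  have i4 : IsStarNormal (blockDiag (V, W)) := ⟨by
    change Commute (star (Matrix.fromBlocks V 0 0 W)) (Matrix.fromBlocks V 0 0 W)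
    rw [Commute, SemiconjBy, hBl.1, hBl.2]⟩
  have h1 := StarAlgHom.map_cfc (S := ℂ) (blockDiag (n := n))
    (fun z : ℂ => ((q z.arg : ℝ) : ℂ)) (V, W) (hq.mono hVW)
    (blockDiag (n := n)).toLinearMap.continuous_of_finiteDimensional i3 i4
  rw [cfc_map_prod (S := ℂ) _ V W ?_ i3 i1 i2] at h1
  · exact h1.symm
  · exact (hq.mono hV).union_of_isClosed (hq.mono hW) (spectrum.isClosed V) (spectrum.isClosed W)

/-! ### Lower bounds for `‖B x‖` and the spectrum -/

section Spectrum

variable {n : Type*} [Fintype n] [DecidableEq n]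

lemma norm_toEuclideanCLM_apply_le (M : Matrix n n ℂ) (x : EuclideanSpace ℂ n) :
    ‖Matrix.toEuclideanCLM (𝕜 := ℂ) M x‖ ≤ ‖M‖ * ‖x‖ :=
  (Matrix.toEuclideanCLM (𝕜 := ℂ) M).le_opNorm x

lemma norm_sq_toEuclideanCLM_apply (M : Matrix n n ℂ) (x : EuclideanSpace ℂ n) :
    ‖Matrix.toEuclideanCLM (𝕜 := ℂ) M x‖ ^ 2
      = RCLike.re (inner ℂ x (Matrix.toEuclideanCLM (𝕜 := ℂ) (star M * M) x)) := by
  rw [ContinuousLinearMap.apply_norm_sq_eq_inner_adjoint_right, map_mul, map_star,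
    ContinuousLinearMap.star_eq_adjoint]
  rfl

/-- If `M* M = 1 + D* D + N`, then `‖M x‖² ≥ (1 - ‖N‖) ‖x‖²`. -/
lemma norm_sq_apply_ge {M D N : Matrix n n ℂ} (hM : star M * M = 1 + star D * D + N) {r : ℝ}
    (hN : ‖N‖ ≤ r) (x : EuclideanSpace ℂ n) :
    (1 - r) * ‖x‖ ^ 2 ≤ ‖Matrix.toEuclideanCLM (𝕜 := ℂ) M x‖ ^ 2 := by
  have h1 := norm_sq_toEuclideanCLM_apply M x
  have h2 := norm_sq_toEuclideanCLM_apply D x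
  rw [hM, map_add, map_add, map_one, add_apply,
    add_apply, inner_add_right, inner_add_right, map_add, map_add, ← h2,
    one_apply_eq_self, inner_self_eq_norm_sq] at h1
  have h3 : |RCLike.re (inner ℂ x (Matrix.toEuclideanCLM (𝕜 := ℂ) N x))| ≤ r * ‖x‖ ^ 2 :=
    calc _ ≤ ‖inner ℂ x (Matrix.toEuclideanCLM (𝕜 := ℂ) N x)‖ := RCLike.abs_re_le_norm _
      _ ≤ ‖x‖ * ‖Matrix.toEuclideanCLM (𝕜 := ℂ) N x‖ := norm_inner_le_norm _ _
      _ ≤ ‖x‖ * (r * ‖x‖) := by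
        gcongr
        exact (norm_toEuclideanCLM_apply_le N x).trans (by gcongr)
      _ = r * ‖x‖ ^ 2 := by ring
  nlinarith [(abs_le.mp h3).1, sq_nonneg ‖Matrix.toEuclideanCLM (𝕜 := ℂ) D x‖]

lemma exists_eigenvector {M : Matrix n n ℂ} {z : ℂ} (hz : z ∈ spectrum ℂ M) :
    ∃ x : EuclideanSpace ℂ n, x ≠ 0 ∧ Matrix.toEuclideanCLM (𝕜 := ℂ) M x = z • x := by
  rw [spectrum.mem_iff, Matrix.isUnit_iff_isUnit_det, isUnit_iff_ne_zero, not_not,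
    ← Matrix.exists_mulVec_eq_zero_iff] at hz
  obtain ⟨v, hv, hv0⟩ := hz
  refine ⟨WithLp.toLp 2 v, by simpa using hv, ?_⟩
  rw [Matrix.toEuclideanCLM_toLp, ← WithLp.toLp_smul]
  rw [Matrix.sub_mulVec, sub_eq_zero, Algebra.algebraMap_eq_smul_one, Matrix.smul_mulVec,
    Matrix.one_mulVec] at hv0
  rw [hv0]

/-- A lower bound for `‖M x‖` bounds the spectrum away from `0`. -/
lemma le_norm_sq_of_mem_spectrum {M : Matrix n n ℂ} {c : ℝ}
    (hM : ∀ x, c * ‖x‖ ^ 2 ≤ ‖Matrix.toEuclideanCLM (𝕜 := ℂ) M x‖ ^ 2) {z : ℂ}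
    (hz : z ∈ spectrum ℂ M) : c ≤ ‖z‖ ^ 2 := by
  obtain ⟨x, hx, hxz⟩ := exists_eigenvector hz
  have h1 := hM x
  rw [hxz, norm_smul, mul_pow] at h1
  exact le_of_mul_le_mul_right h1 (by positivity)

/-- A lower bound for `‖M x‖` bounds the distance from `M` to the singular matrices. -/
lemma le_norm_sub_sq_of_zero_mem_spectrum {M M' : Matrix n n ℂ} {c : ℝ}
    (hM : ∀ x, c * ‖x‖ ^ 2 ≤ ‖Matrix.toEuclideanCLM (𝕜 := ℂ) M x‖ ^ 2)
    (hM' : (0 : ℂ) ∈ spectrum ℂ M') : c ≤ ‖M - M'‖ ^ 2 := by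
  obtain ⟨x, hx, hx0⟩ := exists_eigenvector hM'
  have h1 := hM x
  have h2 : Matrix.toEuclideanCLM (𝕜 := ℂ) M x = Matrix.toEuclideanCLM (𝕜 := ℂ) (M - M') x := by
    rw [map_sub, sub_apply, hx0, zero_smul, sub_zero]
  have h3 := norm_toEuclideanCLM_apply_le (M - M') x
  rw [h2] at h1
  have h4 := h1.trans (pow_le_pow_left₀ (norm_nonneg _) h3 2)
  rw [mul_pow] at h4
  exact le_of_mul_le_mul_right h4 (by positivity)

end Spectrum

/-! ### The matrix `B(U,V)` -/

section BMatrix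

variable {d : ℕ} {U V : Matrix (Fin d) (Fin d) ℂ}

lemma isHermitian_B (U V : Matrix (Fin d) (Fin d) ℂ) : (B U V).IsHermitian := by
  refine Matrix.IsHermitian.fromBlocks (star_fc f V) ?_ (by
    rw [Matrix.IsHermitian, Matrix.conjTranspose_neg]
    exact congrArg Neg.neg (star_fc f V))
  change star (fc g V + (1 / 2 : ℂ) • (fc h V * U + U * fc h V)) = _
  rw [star_add, star_smul, star_add, star_mul, star_mul, star_fc, star_fc, add_comm (star U * _)]
  simp

/-- With `e` and `φ` bounding `‖[h[V], U]‖` and `‖[f[V], U]‖`, the square of `B(U,V)` is at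
least `1 - (e · min 2 √(1 + 2e) + φ)`. -/
lemma norm_sq_B_apply_ge (hU : U ∈ unitary (Matrix (Fin d) (Fin d) ℂ))
    (hV : V ∈ unitary (Matrix (Fin d) (Fin d) ℂ)) {e φ : ℝ}
    (he : ‖fc h V * U - U * fc h V‖ ≤ e) (hφ : ‖fc f V * U - U * fc f V‖ ≤ φ)
    (x : EuclideanSpace ℂ (Fin d ⊕ Fin d)) :
    (1 - (e * min 2 (Real.sqrt (1 + 2 * e)) + φ)) * ‖x‖ ^ 2
      ≤ ‖Matrix.toEuclideanCLM (𝕜 := ℂ) (B U V) x‖ ^ 2 := by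
  have hU' := Unitary.star_mem hU
  have hcf := circleContinuous_f
  have hcg := circleContinuous_g
  have hch := circleContinuous_h
  have hG1 : ‖fc g V‖ ≤ 1 := norm_fc_le zero_le_one abs_g_le_one V
  have hH1 : ‖fc h V‖ ≤ 1 := norm_fc_le zero_le_one abs_h_le_one V
  have hGH : fc g V * fc h V = 0 := by
    rw [← fc_mul hV hcg hch]
    simp only [g_mul_h, fc_const hV, Complex.ofReal_zero, map_zero]
  have hHG : fc h V * fc g V = 0 := by rw [commute_fc, hGH]
  have h1 : fc f V * fc f V + fc g V * fc g V + fc h V * fc h V = 1 := by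
    rw [← fc_mul hV hcf hcf, ← fc_mul hV hcg hcg, ← fc_mul hV hch hch,
      ← fc_add hV (hcf.mul hcf) (hcg.mul hcg),
      ← fc_add hV ((hcf.mul hcf).add (hcg.mul hcg)) (hch.mul hch)]
    simp only [← sq, f_sq_add_g_sq_add_h_sq, fc_const hV,
      Complex.ofReal_one, map_one]
  have hsq : ‖fc g V * fc g V + fc h V * fc h V‖ ≤ 1 := by
    rw [← fc_mul hV hcg hcg, ← fc_mul hV hch hch, ← fc_add hV (hcg.mul hcg) (hch.mul hch)]
    refine norm_fc_le zero_le_one (fun x => ?_) V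
    rw [abs_of_nonneg (add_nonneg (mul_self_nonneg _) (mul_self_nonneg _))]
    nlinarith [f_sq_add_g_sq_add_h_sq x, sq_nonneg (f x)]
  have hFG := commute_fc f g V
  have hFH := commute_fc f h V
  have hFs := star_fc f V
  have hGs := star_fc g V
  have hHs := star_fc h V
  have hB : star (B U V) = B U V := isHermitian_B U V
  unfold B at hB ⊢
  generalize fc f V = F at *
  generalize fc g V = G at *
  generalize fc h V = H at *
  have he' := (norm_comm_star_right (U := U) hHs).trans_le he
  have hφ' := (norm_comm_star_right (U := U) hFs).trans_le hφ
  have d1 := diag_block_eq hU hGH hHG h1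
  have d2 := diag_block_eq hU' hGH hHG h1
  have n1 := norm_diag_error_le hU hGs hHs hG1 hH1 hHG hsq he
  have n2 := norm_diag_error_le hU' hGs hHs hG1 hH1 hHG hsq he'
  have o1 := offDiag_block_eq (U := U) hFG hFH
  have o2 := offDiag_block_eq (U := star U) hFG hFH
  have m1 := norm_half_smul_anticomm_le hH1 hφ
  have m2 := (norm_neg _).trans_le (norm_half_smul_anticomm_le hH1 hφ')
  have s1 := star_half_smul_conj_sub (U := U) hHs
  have s2 := star_half_smul_conj_sub (U := star U) hHs
  rw [star_star] at d2 n2 s2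
  refine norm_sq_apply_ge (D := Matrix.fromBlocks ((1 / 2 : ℂ) • (U * H * star U - H)) 0 0
    ((1 / 2 : ℂ) • (star U * H * U - H))) ?_ ((norm_add_le _ _).trans (add_le_add
      (norm_fromBlocks_diag_le n1 n2) (norm_fromBlocks_offDiag_le m1 m2))) x
  rw [hB, star_fromBlocks, s1, s2, star_zero, ← Matrix.fromBlocks_one,
    Matrix.fromBlocks_multiply, Matrix.fromBlocks_multiply, Matrix.fromBlocks_add,
    Matrix.fromBlocks_add, Matrix.fromBlocks_add]
  simp only [mul_zero, zero_mul, add_zero, zero_add]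
  rw [← d1, ← d2, ← o1, ← o2]
  generalize G + (1 / 2 : ℂ) • (H * U + U * H) = X
  generalize G + (1 / 2 : ℂ) • (H * star U + star U * H) = Y
  congr 1 <;> noncomm_ring

/-- The commutator modulus controls the modulus of continuity: a difference `q[V] - q[W]` is
the off-diagonal block of the commutator of `q[diag(V, W)]` with the block swap. -/
lemma norm_fc_sub_le {q : ℝ → ℝ} (hq : ∀ x, |q x| ≤ 1) (hqc : CircleContinuous q)
    {V W : Matrix (Fin d) (Fin d) ℂ} (hV : V ∈ unitary (Matrix (Fin d) (Fin d) ℂ))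
    (hW : W ∈ unitary (Matrix (Fin d) (Fin d) ℂ)) :
    ‖fc q V - fc q W‖ ≤ eta q ‖V - W‖ := by
  -- The swap matrix, which is unitary, produces the difference in both off-diagonal blocks.
  have hcomm (X Y : Matrix (Fin d) (Fin d) ℂ) :
      Matrix.fromBlocks X 0 0 Y * Matrix.fromBlocks 0 1 1 0
        - Matrix.fromBlocks 0 1 1 0 * Matrix.fromBlocks X 0 0 Y
        = Matrix.fromBlocks 0 (X - Y) (Y - X) 0 := by
    rw [Matrix.fromBlocks_multiply, Matrix.fromBlocks_multiply, fromBlocks_sub]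
    simp
  have h1 := le_eta hq (a := Matrix.fromBlocks 0 1 1 0) (δ := ‖V - W‖)
    (blockDiag_mem_unitary hV hW) (norm_le_one_of_mem_unitary swap_mem_unitary) (by
      rw [hcomm]
      exact norm_fromBlocks_offDiag_le le_rfl (norm_sub_rev W V).le)
  rw [fc_fromBlocks_diag hqc hV hW, hcomm] at h1
  exact (norm_le_norm_fromBlocks_offDiag _ _).trans h1

lemma neg_mem_unitary (hV : V ∈ unitary (Matrix (Fin d) (Fin d) ℂ)) :
    -V ∈ unitary (Matrix (Fin d) (Fin d) ℂ) := by
  rw [Unitary.mem_iff] at hV ⊢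
  simpa using hV

lemma B_sub_eq (U V U₁ V₁ : Matrix (Fin d) (Fin d) ℂ) :
    B U V - B U₁ V₁
      = (Matrix.fromBlocks (fc f V - fc f V₁) 0 0 (-(fc f V - fc f V₁))
        + Matrix.fromBlocks 0 (fc g V - fc g V₁) (fc g V - fc g V₁) 0)
      + (Matrix.fromBlocks 0
          ((1 / 2 : ℂ) • (U₁ * (fc h V - fc h V₁) + (fc h V - fc h V₁) * U₁))
          ((1 / 2 : ℂ) • (star U₁ * (fc h V - fc h V₁) + (fc h V - fc h V₁) * star U₁)) 0
        + Matrix.fromBlocks 0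
          ((1 / 2 : ℂ) • (fc h V * (U - U₁) + (U - U₁) * fc h V))
          ((1 / 2 : ℂ) • (fc h V * star (U - U₁) + star (U - U₁) * fc h V)) 0) := by
  rw [B, B, fromBlocks_sub, Matrix.fromBlocks_add, Matrix.fromBlocks_add,
    Matrix.fromBlocks_add, star_sub]
  simp only [add_zero, zero_add, mul_sub, sub_mul, smul_add, smul_sub]
  congr 1 <;> abel

/-- Moving `U` costs at most `‖U - U₁‖` because `‖h[V]‖ ≤ 1`; moving `V` costs `η_f + 2 η_h`,
since `g[V] = h[-V]` has the same modulus of continuity as `h[V]`. -/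
lemma norm_B_sub_le {U₁ V₁ : Matrix (Fin d) (Fin d) ℂ}
    (hV : V ∈ unitary (Matrix (Fin d) (Fin d) ℂ))
    (hU₁ : U₁ ∈ unitary (Matrix (Fin d) (Fin d) ℂ))
    (hV₁ : V₁ ∈ unitary (Matrix (Fin d) (Fin d) ℂ)) :
    ‖B U V - B U₁ V₁‖ ≤ ‖U - U₁‖ + beta ‖V - V₁‖ := by
  have hF := norm_fc_sub_le abs_f_le_one circleContinuous_f hV hV₁
  have hH := norm_fc_sub_le abs_h_le_one circleContinuous_h hV hV₁
  have hG : ‖fc g V - fc g V₁‖ ≤ eta h ‖V - V₁‖ := by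
    have h1 := norm_fc_sub_le abs_h_le_one circleContinuous_h (neg_mem_unitary hV)
      (neg_mem_unitary hV₁)
    rwa [← fc_g_eq_fc_h_neg hV, ← fc_g_eq_fc_h_neg hV₁, neg_sub_neg, norm_sub_rev V₁ V] at h1
  have hH1 : ‖fc h V‖ ≤ 1 := norm_fc_le zero_le_one abs_h_le_one V
  have hU₁' := Unitary.star_mem hU₁
  rw [B_sub_eq, beta]
  generalize fc f V - fc f V₁ = F at *
  generalize fc g V - fc g V₁ = G at *
  generalize fc h V - fc h V₁ = H at *
  have k1 := norm_fromBlocks_diag_le hF ((norm_neg F).trans_le hF)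
  have k2 := norm_fromBlocks_offDiag_le hG hG
  have k3 := norm_fromBlocks_offDiag_le
    (norm_half_smul_anticomm_le (norm_le_one_of_mem_unitary hU₁) hH)
    (norm_half_smul_anticomm_le (norm_le_one_of_mem_unitary hU₁') hH)
  have k4 := norm_fromBlocks_offDiag_le (norm_half_smul_anticomm_le hH1 (le_refl ‖U - U₁‖))
    (norm_half_smul_anticomm_le hH1 (norm_star (U - U₁)).le)
  exact (norm_add_le_of_le (norm_add_le_of_le k1 k2) (norm_add_le_of_le k3 k4)).trans
    (by linarith)

end BMatrix

end LoringBott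

end

open LoringBott in
/-- In the conclusion `√(1 - 5δ)` is read as `0` for `1/5 < δ ≤ 0.206007`; there the first part
still says that `0` is not in the spectrum of `B(U,V)`. -/
theorem mainTheorem2 {d : ℕ} (U V : Matrix (Fin d) (Fin d) ℂ)
    (hU : U ∈ Matrix.unitaryGroup (Fin d) ℂ) (hV : V ∈ Matrix.unitaryGroup (Fin d) ℂ)
    (δ : ℝ) (hδ : δ = ‖U * V - V * U‖) (hδ_le : δ ≤ 0.206007) :
    ((LoringBott.B U V).IsHermitian ∧
      (0 : ℂ) ∉ spectrum ℂ (LoringBott.B U V) ∧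
      LoringBott.HasGapAtZero (LoringBott.B U V) (19 / 20 * Real.sqrt (1 - 5 * δ)) ∧
      LoringBott.HasGapAtZero (LoringBott.B U V) (LoringBott.gapBound δ) ∧
      19 / 20 * Real.sqrt (1 - 5 * δ) ≤ LoringBott.gapBound δ) ∧
    ((∀ U₁ V₁ : Matrix (Fin d) (Fin d) ℂ,
      U₁ ∈ Matrix.unitaryGroup (Fin d) ℂ → V₁ ∈ Matrix.unitaryGroup (Fin d) ℂ →
      (0 : ℂ) ∈ spectrum ℂ (LoringBott.B U₁ V₁) →
        1 / 5 * Real.sqrt (1 - 5 * δ) ≤ ‖U - U₁‖ + ‖V - V₁‖ ∧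
        LoringBott.moveBound δ ≤ ‖U - U₁‖ + ‖V - V₁‖) ∧
      1 / 5 * Real.sqrt (1 - 5 * δ) ≤ LoringBott.moveBound δ) := by
  have h0 : 0 ≤ δ := hδ ▸ norm_nonneg _
  have hU1 : ‖U‖ ≤ 1 := norm_le_one_of_mem_unitary hU
  have hVU : ‖V * U - U * V‖ ≤ δ := by rw [norm_sub_rev, hδ]
  have he := le_eta abs_h_le_one hV hU1 hVU
  have hφ := le_eta abs_f_le_one hV hU1 hVU
  have he0 : 0 ≤ eta h δ := (norm_nonneg _).trans he
  have key := norm_sq_B_apply_ge hU hV he hφ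
  have hκ : eta h δ * min 2 (Real.sqrt (1 + 2 * eta h δ)) + eta f δ ≤ beta δ := by
    rw [beta]
    nlinarith [min_le_left 2 (Real.sqrt (1 + 2 * eta h δ))]
  have hbound (x : EuclideanSpace ℂ (Fin d ⊕ Fin d)) :
      (1 - beta δ) * ‖x‖ ^ 2 ≤ ‖Matrix.toEuclideanCLM (𝕜 := ℂ) (B U V) x‖ ^ 2 :=
    (mul_le_mul_of_nonneg_right (by linarith) (sq_nonneg _)).trans (key x)
  have hgap : HasGapAtZero (B U V) (gapBound δ) := fun z hz =>
    Real.sqrt_le_iff.mpr ⟨norm_nonneg _, le_norm_sq_of_mem_spectrum hbound hz⟩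
  -- Beyond `δ = 1/5` the available upper bound for `β(δ)` exceeds `1`; the factor
  -- `√(1 + 2η) ≤ 1.3` in place of `2` gives `0.32 * 1.3 + 1.875 * 0.206007 < 1`.
  have hzero : (0 : ℂ) ∉ spectrum ℂ (B U V) := fun hz => by
    have h1 := le_norm_sq_of_mem_spectrum key hz
    have h2 : eta h δ ≤ 32 / 100 := (eta_h_le h0).trans (by linarith)
    have h3 := eta_f_le h0
    have h4 : min 2 (Real.sqrt (1 + 2 * eta h δ)) ≤ 13 / 10 :=
      (min_le_right _ _).trans (Real.sqrt_le_iff.mpr ⟨by norm_num, by linarith⟩)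
    rw [norm_zero] at h1
    nlinarith
  have hmove := sqrt_le_moveBound h0
  have hdist (U₁ V₁ : Matrix (Fin d) (Fin d) ℂ) (hU₁ : U₁ ∈ Matrix.unitaryGroup (Fin d) ℂ)
      (hV₁ : V₁ ∈ Matrix.unitaryGroup (Fin d) ℂ) (hz : (0 : ℂ) ∈ spectrum ℂ (B U₁ V₁)) :
      moveBound δ ≤ ‖U - U₁‖ + ‖V - V₁‖ := by
    refine csInf_le ⟨0, ?_⟩ ⟨_, _, norm_nonneg _, norm_nonneg _, rfl, ?_⟩
    · rintro t ⟨a, b, ha, hb, rfl, -⟩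
      exact add_nonneg ha hb
    · refine le_trans ?_ (norm_B_sub_le hV hU₁ hV₁)
      exact Real.sqrt_le_iff.mpr
        ⟨norm_nonneg _, le_norm_sub_sq_of_zero_mem_spectrum hbound hz⟩
  exact ⟨⟨isHermitian_B U V, hzero, fun z hz => (sqrt_le_gapBound h0).trans (hgap z hz), hgap,
    sqrt_le_gapBound h0⟩, fun U₁ V₁ hU₁ hV₁ hz =>
      ⟨hmove.trans (hdist U₁ V₁ hU₁ hV₁ hz), hdist U₁ V₁ hU₁ hV₁ hz⟩, hmove⟩
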